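/- Let $M$ be a cotransversal matroid on a finite ground set $E$, i.e. a matroid whose dual $M^*$ is transversal, and let $r$ be the rank of $M^*$. A presentation of $M^*$ is a finite family $(A_1,\dots,A_m)$ of subsets of $E$ such that the independent sets of $M^*$ are exactly the partial transversals of the family (the sets $\{e_1,\dots,e_k\}$ of distinct elements with $e_i\in A_{j_i}$ for distinct indices $j_1,\dots,j_k$). Then $M^*$ has a presentation with exactly $r$ members, and the following holds for every presentation $(A_1,\dots,A_r)$ of $M^*$ with exactly $r$ members. For $I\subseteq[r]$ let $l_I$ be the number of $e\in E$ with $\{j: e\in A_j\}=I$, let $\Delta_{\{0\}\cup I}\subset\mathbb R^r$ be the convex hull of the origin and the unit vectors $e_i$, $i\in I$, and let $$P_{M^*}=\sum_{I\subseteq[r]} l_I\,\Delta_{\{0\}\cup I}$$ (Minkowski sum) be the transversalhedron. Let $X$ be the set of monomials $x_1^{c_1-1}\cdots x_r^{c_r-1}$, where $(c_1,\dots,c_r)$ runs over the lattice points of $P_{M^*}$ lying on none of the coordinate hyperplanes $x_i=0$. Then $X$ is a pure monomial order ideal, i.e. a finite set of monomials that contains every divisor of each of its members and all of whose maximal members under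 divisibility have the same degree. Moreover its degree sequence is the $h$-vector of $M$: for every $k\ge 0$ the number of monomials of degree $k$ in $X$ equals $h_k$, where, with $d$ the rank of $M$ and $f_{i-1}$ the number of $i$-element independent sets of $M$, the $h_k$ are defined by $\sum_k h_kx^k=\sum_{i=0}^{d} f_{i-1}x^i(1-x)^{d-i}$ (so $h_k=0$ for $k>d$). -/

import Mathlib

open scoped Pointwise

noncomputable section

namespace Cotransversal

/-- The family `A = (A_1, …, A_m)` of subsets of the ground set is a presentation of `N`:
the independent sets of `N` are the partial transversals of `A`, that is, the sets of
left-hand vertices of matchings in the bipartite graph with an edge `(e, j)` whenever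
`e ∈ A j`. -/
def IsPresentation {α : Type*} (N : Matroid α) {m : ℕ} (A : Fin m → Set α) : Prop :=
  (∀ j, A j ⊆ N.E) ∧
    ∀ I : Set α, N.Indep I ↔ ∃ f : I → Fin m, Function.Injective f ∧ ∀ e : I, (e : α) ∈ A (f e)

/-- A transversal matroid: one with a presentation by finitely many sets. -/
def IsTransversal {α : Type*} (N : Matroid α) : Prop :=
  ∃ (m : ℕ) (A : Fin m → Set α), IsPresentation N A

/-- A cotransversal matroid: its dual is transversal. -/
def IsCotransversal {α : Type*} (M : Matroid α) : Prop :=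
  IsTransversal (Matroid.dual M)

/-- The number `l_I` of elements of `E` of type exactly `I`, the type of `e` being
`{j | e ∈ A j}`. -/
def typeCount {α : Type*} (E : Set α) {r : ℕ} (A : Fin r → Set α) (I : Finset (Fin r)) : ℕ :=
  {e ∈ E | ∀ j, j ∈ I ↔ e ∈ A j}.ncard

/-- The simplex `Δ_{{0} ∪ I}`: the convex hull of the origin and the `e_i` with `i ∈ I`. -/
def simplexWithOrigin {r : ℕ} (I : Finset (Fin r)) : Set (Fin r → ℝ) :=
  convexHull ℝ (insert 0 ((fun i => Pi.single i (1 : ℝ)) '' (I : Set (Fin r))))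

/-- The transversalhedron: the Minkowski sum over all `I ⊆ [r]` of the dilates
`l_I • Δ_{{0} ∪ I}`. -/
def transversalhedron {α : Type*} (E : Set α) {r : ℕ} (A : Fin r → Set α) : Set (Fin r → ℝ) :=
  ∑ I : Finset (Fin r), (typeCount E A I : ℝ) • simplexWithOrigin I

/-- The monomials `x_1^{c_1 - 1} ⋯ x_r^{c_r - 1}`, given by their exponent vectors, for the
lattice points `c` of `P` that lie on no coordinate hyperplane. -/
def latticeMonomials {r : ℕ} (P : Set (Fin r → ℝ)) : Set (Fin r →₀ ℕ) :=
  {m | ∃ c : Fin r → ℤ, (fun i => (c i : ℝ)) ∈ P ∧ (∀ i, c i ≠ 0) ∧ ∀ i, (m i : ℤ) = c i - 1}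

/-- A pure monomial order ideal, monomials being given by their exponent vectors (so that
divisibility is `≤`): a finite set of monomials closed under divisors, all of whose maximal
elements have the same degree. -/
structure IsPureOrderIdeal {σ : Type*} (X : Set (σ →₀ ℕ)) : Prop where
  finite : X.Finite
  dvd_closed : ∀ m ∈ X, ∀ n, n ≤ m → n ∈ X
  pure : ∀ m n, Maximal (· ∈ X) m → Maximal (· ∈ X) n → m.degree = n.degree

/-- The number of monomials of degree `k` in `X`. -/
def degreeSequence {σ : Type*} (X : Set (σ →₀ ℕ)) (k : ℕ) : ℕ :=
  {m ∈ X | m.degree = k}.ncard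

/-- The number of `k`-element independent sets (faces of dimension `k - 1` of the
independence complex). -/
def indepCount {α : Type*} (M : Matroid α) (k : ℕ) : ℕ :=
  {I : Set α | M.Indep I ∧ I.encard = k}.ncard

open Polynomial in
/-- The `h`-polynomial `∑ h_k x^k = ∑_{i ≤ d} f_{i-1} x^i (1 - x)^{d-i}` of the independence
complex of a matroid of finite rank `d`. -/
def hPolynomial {α : Type*} (M : Matroid α) : ℤ[X] :=
  ∑ i ∈ Finset.range (M.eRank.toNat + 1),
    C (indepCount M i : ℤ) * X ^ i * (1 - X) ^ (M.eRank.toNat - i)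

/-- The entries of the `h`-vector of `M` (zero beyond the rank of `M`). -/
def hVector {α : Type*} (M : Matroid α) (k : ℕ) : ℤ :=
  (hPolynomial M).coeff k

end Cotransversal

end

/-! Write `N(J)` for the elements lying in some `A j` with `j ∈ J`. Complementing independent sets
of `M` gives spanning sets of the dual, and with `r` presenting sets these are the `S` with `|S ∩
N(J)| ≥ |J|` for all `J` (Hall). So the `h`-polynomial is `∑ x^|E \ S| (1 - x)^(|S| - r)` over such
`S`, which is `setPolynomial`. On the other side, Hall's theorem also identifies the lattice points
of the transversalhedron off the coordinate hyperplanes: they are the positive integer vectors `c`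
with `c(J) ≤ |N(J)|` for all `J`. Their generating function by degree is `vectorPolynomial`.

The two polynomials agree because they satisfy one recursion. For an index set `V`, a ground set `E`
and `i ∈ V`, `F(V \ i, E) + (x - 1) F(V, E) = ∑ κ(U) x^(|N(U)| + 1 - |U|) F(V \ U, E \ N(U))`,
summed over `U` with `i ∈ U ⊆ V`. The right side counts objects that break the inequalities by at
most one, and only on sets containing `i`. Submodularity gives each of them a least violated set
`U`, along which it splits into a critical object on `U` and an unconstrained choice of good object
on the rest.

The number `κ(U)` counts critical sets in one case and critical vectors in the other. No bijection
between them is built: in the induction on `|V|` only the term `U = V` is new, and setting `x = 1`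
kills `F(V, E)` and forces the two values of `κ(V)` to agree. Cancelling `x - 1` then gives equality
of the polynomials.

Purity is the usual polymatroid argument: tight sets are closed under union. -/

namespace Cotransversal

open Finset Polynomial
open scoped Classical

/-! ### Least violated sets of submodular functions -/

section Submodular

variable {ι β R : Type*}

/-- `φ` takes values `≥ 0` on subsets of `V` avoiding `i`, values `≥ -1` on all subsets of `V`,
and a negative value somewhere. -/
def IsDeficient (V : Finset ι) (i : ι) (φ : Finset ι → ℤ) : Prop :=
  (∀ J ⊆ V, i ∉ J → 0 ≤ φ J) ∧ (∀ J ⊆ V, -1 ≤ φ J) ∧ ∃ J ⊆ V, φ J < 0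

/-- `U` is the smallest subset of `V` on which `φ` is negative, and `φ U = -1` is the minimum
of `φ` over the sets containing `U`. -/
def IsLeastViolator (V : Finset ι) (φ : Finset ι → ℤ) (U : Finset ι) : Prop :=
  φ U = -1 ∧ (∀ J ⊂ U, 0 ≤ φ J) ∧ ∀ J ⊆ V \ U, -1 ≤ φ (J ∪ U)

/-- Submodularity applied to `K` and `U`: passing from `U` to `K ∪ U` cannot lower the value below
`-1 = φ U`. -/
theorem IsLeastViolator.le_of_submodular {V U K : Finset ι} {φ : Finset ι → ℤ}
    (hφ : ∀ J K, φ (J ∪ K) + φ (J ∩ K) ≤ φ J + φ K) (hU : IsLeastViolator V φ U) (hK : K ⊆ V) :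
    φ (K ∩ U) ≤ φ K := by
  have h1 := hφ K U
  have h2 := hU.2.2 (K \ U) (sdiff_subset_sdiff hK subset_rfl)
  rw [sdiff_union_self_eq_union] at h2
  have := hU.1
  linarith

/-- `K ∩ U` is again negative, while `φ` is nonnegative on proper subsets of `U`. Hence least
violators are unique. -/
theorem IsLeastViolator.subset {V U K : Finset ι} {φ : Finset ι → ℤ}
    (hφ : ∀ J K, φ (J ∪ K) + φ (J ∩ K) ≤ φ J + φ K) (hU : IsLeastViolator V φ U) (hK : K ⊆ V)
    (hneg : φ K < 0) : U ⊆ K := by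
  have h := hU.le_of_submodular hφ hK
  by_contra hn
  have : K ∩ U ⊂ U := by
    refine ⟨inter_subset_right, fun h' => hn (h'.trans inter_subset_left)⟩
  have := hU.2.1 _ this
  linarith

theorem IsLeastViolator.isDeficient {V U : Finset ι} {i : ι} {φ : Finset ι → ℤ}
    (hφ : ∀ J K, φ (J ∪ K) + φ (J ∩ K) ≤ φ J + φ K) (hU : IsLeastViolator V φ U) (hUV : U ⊆ V)
    (hi : i ∈ U) : IsDeficient V i φ := by
  refine ⟨fun J hJ hiJ => ?_, fun J hJ => ?_, U, hUV, by rw [hU.1]; norm_num⟩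
  · by_contra! h
    exact hiJ (hU.subset hφ hJ h hi)
  · by_cases h : φ J < 0
    · have h' := hU.le_of_submodular hφ hJ
      rw [inter_eq_right.2 (hU.subset hφ hJ h), hU.1] at h'
      exact h'
    · linarith

theorem IsDeficient.exists_isLeastViolator {V : Finset ι} {i : ι} {φ : Finset ι → ℤ}
    (h : IsDeficient V i φ) : ∃ U ⊆ V, i ∈ U ∧ IsLeastViolator V φ U := by
  obtain ⟨h0, h1, J, hJ, hneg⟩ := h
  obtain ⟨U, hU⟩ := (V.powerset.filter fun K => φ K < 0).exists_minimal
    ⟨J, by simp [hJ, hneg]⟩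
  have hU1 := hU.prop
  simp only [mem_filter, mem_powerset] at hU1
  obtain ⟨hUV, hUneg⟩ := hU1
  refine ⟨U, hUV, ?_, ?_, fun K hK => ?_, fun K hK => ?_⟩
  · by_contra hi
    have := h0 U hUV hi
    linarith
  · have := h1 U hUV
    lia
  · by_contra! hn
    exact hK.2 (hU.le_of_le (by simp [hK.1.trans hUV, hn]) hK.1)
  · exact h1 _ (union_subset (hK.trans sdiff_subset) hUV)

/-- A deficient `φ s` has exactly one least violator in `V`, and it contains `i`; conversely a least
violator containing `i` makes `φ s` deficient. So deficient objects can be sorted by `U`. -/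
theorem sum_isDeficient [AddCommMonoid R] (T : Finset β) (V : Finset ι) (i : ι)
    (φ : β → Finset ι → ℤ) (hφ : ∀ s J K, φ s (J ∪ K) + φ s (J ∩ K) ≤ φ s J + φ s K) (w : β → R) :
    ∑ s ∈ T with IsDeficient V i (φ s), w s =
      ∑ U ∈ V.powerset with i ∈ U, ∑ s ∈ T with IsLeastViolator V (φ s) U, w s := by
  simp_rw [sum_filter (s := T)]
  rw [sum_comm]
  refine sum_congr rfl fun s _ => ?_
  by_cases h : IsDeficient V i (φ s)
  · obtain ⟨U, hUV, hiU, hU⟩ := h.exists_isLeastViolator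
    rw [if_pos h, sum_eq_single U]
    · rw [if_pos hU]
    · intro K hK hne
      rw [mem_filter, mem_powerset] at hK
      rw [if_neg]
      intro hK'
      exact hne (subset_antisymm (hK'.subset (hφ s) hUV (by rw [hU.1]; norm_num))
        (hU.subset (hφ s) hK.1 (by rw [hK'.1]; norm_num)))
    · intro hn
      exact absurd (by simp [hUV, hiU]) hn
  · rw [if_neg h, sum_eq_zero]
    intro K hK
    rw [mem_filter, mem_powerset] at hK
    rw [if_neg]
    exact fun hK' => h (hK'.isDeficient (hφ s) hK.1 hK.2)

end Submodular

/-! ### The recursion for sets satisfying Hall's condition -/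

section Recursion

variable {ι α : Type*} (A : ι → Set α)

/-- The elements of `S` lying in some `A j` with `j ∈ J`. -/
noncomputable def nbr (S : Finset α) (J : Finset ι) : Finset α :=
  S.filter fun e => ∃ j ∈ J, e ∈ A j

theorem mem_nbr {S : Finset α} {J : Finset ι} {e : α} :
    e ∈ nbr A S J ↔ e ∈ S ∧ ∃ j ∈ J, e ∈ A j := by
  simp [nbr]

theorem nbr_subset (S : Finset α) (J : Finset ι) : nbr A S J ⊆ S := filter_subset _ _

theorem nbr_mono {S T : Finset α} {J K : Finset ι} (hS : S ⊆ T) (hJ : J ⊆ K) :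
    nbr A S J ⊆ nbr A T K := by
  intro e
  simp only [mem_nbr]
  exact fun ⟨h1, j, hj, h2⟩ => ⟨hS h1, j, hJ hj, h2⟩

theorem nbr_union [DecidableEq ι] (S : Finset α) (J K : Finset ι) :
    nbr A S (J ∪ K) = nbr A S J ∪ nbr A S K := by
  ext e
  simp only [mem_nbr, mem_union]
  grind

theorem nbr_inter_subset [DecidableEq ι] (S : Finset α) (J K : Finset ι) :
    nbr A S (J ∩ K) ⊆ nbr A S J ∩ nbr A S K :=
  subset_inter (nbr_mono A subset_rfl inter_subset_left)
    (nbr_mono A subset_rfl inter_subset_right)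

theorem card_nbr_submodular [DecidableEq ι] (S : Finset α) (J K : Finset ι) :
    #(nbr A S (J ∪ K)) + #(nbr A S (J ∩ K)) ≤ #(nbr A S J) + #(nbr A S K) := by
  rw [nbr_union, ← card_union_add_card_inter (nbr A S J)]
  exact Nat.add_le_add_left (card_le_card (nbr_inter_subset A S J K)) _

/-- Once `U` is fixed, the conditions at `J ∪ U` become conditions at `J` on the ground set with
`N(U)` deleted. -/
theorem card_nbr_union (S : Finset α) (J U : Finset ι) :
    #(nbr A S (J ∪ U)) = #(nbr A (S \ nbr A S U) J) + #(nbr A S U) := by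
  rw [← card_union_of_disjoint]
  · congr 1
    ext e
    simp only [mem_nbr, mem_union, mem_sdiff]
    grind
  · exact disjoint_of_subset_left (nbr_subset A _ _) sdiff_disjoint

/-- The subsets of `E` containing a transversal of `(A j)_{j ∈ V}`, in terms of Hall's
condition. -/
noncomputable def hallSets (V : Finset ι) (E : Finset α) : Finset (Finset α) :=
  E.powerset.filter fun S => ∀ J ⊆ V, #J ≤ #(nbr A S J)

/-- The sets meeting Hall's condition for all proper subsets of `U`, but one element short of a
transversal of `(A j)_{j ∈ U}`. -/
noncomputable def criticalSets (U : Finset ι) (E : Finset α) : Finset (Finset α) :=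
  (nbr A E U).powerset.filter fun S => #S + 1 = #U ∧ ∀ J ⊂ U, #J ≤ #(nbr A S J)

/-- The generating function `∑ x ^ |E \ S| (1 - x) ^ (|S| - |V|)` of `hallSets`. -/
noncomputable def setPolynomial (V : Finset ι) (E : Finset α) : ℤ[X] :=
  ∑ S ∈ hallSets A V E, X ^ (#E - #S) * (1 - X) ^ (#S - #V)

theorem mem_hallSets {V : Finset ι} {E S : Finset α} :
    S ∈ hallSets A V E ↔ S ⊆ E ∧ ∀ J ⊆ V, #J ≤ #(nbr A S J) := by
  simp [hallSets]

theorem mem_criticalSets {U : Finset ι} {E S : Finset α} :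
    S ∈ criticalSets A U E ↔
      S ⊆ nbr A E U ∧ #S + 1 = #U ∧ ∀ J ⊂ U, #J ≤ #(nbr A S J) := by
  simp [criticalSets]

theorem card_le_of_mem_hallSets {V : Finset ι} {E S : Finset α} (h : S ∈ hallSets A V E) :
    #V ≤ #S :=
  (((mem_hallSets A).1 h).2 V subset_rfl).trans (card_le_card (nbr_subset A _ _))

/-- The excess of `S` over `J` in Hall's condition. -/
noncomputable def setExcess (S : Finset α) (J : Finset ι) : ℤ := #(nbr A S J) - #J

theorem setExcess_submodular (S : Finset α) (J K : Finset ι) :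
    setExcess A S (J ∪ K) + setExcess A S (J ∩ K) ≤ setExcess A S J + setExcess A S K := by
  have h1 := card_nbr_submodular A S J K
  have h2 := card_union_add_card_inter J K
  simp only [setExcess]
  lia

/-- The bound `-1` is automatic: removing `i` from `J` lowers `|J|` by at most one and does not
enlarge the neighbourhood. -/
theorem isDeficient_setExcess_iff {V : Finset ι} {i : ι} {E S : Finset α}
    (hS : S ⊆ E) :
    IsDeficient V i (setExcess A S) ↔ S ∈ hallSets A (V.erase i) E ∧ S ∉ hallSets A V E := by
  simp only [IsDeficient, mem_hallSets, setExcess, hS, true_and, not_forall]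
  constructor
  · rintro ⟨h0, -, J, hJ, hneg⟩
    refine ⟨fun K hK => ?_, J, hJ, by lia⟩
    have := h0 K (hK.trans (erase_subset _ _)) (fun h => by simpa using hK h)
    lia
  · rintro ⟨h0, J, hJ, hneg⟩
    refine ⟨fun K hK hiK => ?_, fun K hK => ?_, J, hJ, by lia⟩
    · have := h0 K (subset_erase.2 ⟨hK, hiK⟩)
      lia
    · have h1 := h0 (K.erase i) (erase_subset_erase _ hK)
      have h2 := pred_card_le_card_erase (s := K) (a := i)
      have h3 := card_le_card (nbr_mono A (subset_refl S) (erase_subset i K))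
      lia

/-- Conditions below `U` see only `S ∩ N(U)`. Above `U`, the deficit `-1` at `U` cancels the allowed
`-1` at `J ∪ U`, leaving exactly Hall's condition for the rest of `S`. -/
theorem isLeastViolator_setExcess_iff {V U : Finset ι} {E S : Finset α}
    (hS : S ⊆ E) :
    IsLeastViolator V (setExcess A S) U ↔
      nbr A S U ∈ criticalSets A U E ∧
        S \ nbr A S U ∈ hallSets A (V \ U) (E \ nbr A E U) := by
  have e1 : ∀ J ⊂ U, nbr A (nbr A S U) J = nbr A S J := by
    intro J hJ
    ext e
    simp only [mem_nbr]
    have := hJ.1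
    grind
  have e2 : S \ nbr A S U ⊆ E \ nbr A E U := by
    intro e
    simp only [mem_sdiff, mem_nbr]
    have := @hS e
    grind
  simp only [IsLeastViolator, mem_criticalSets, mem_hallSets, setExcess, e2,
    nbr_mono A hS subset_rfl, true_and, and_assoc]
  have e3 : #(nbr A S U) + 1 = #U → ((∀ J ⊆ V \ U, -1 ≤ (#(nbr A S (J ∪ U)) : ℤ) - #(J ∪ U)) ↔
      ∀ J ⊆ V \ U, #J ≤ #(nbr A (S \ nbr A S U) J)) := by
    intro h
    refine forall₂_congr fun J hJ => ?_
    rw [card_nbr_union, card_union_of_disjoint (disjoint_of_subset_left hJ sdiff_disjoint)]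
    lia
  have e4 : (#(nbr A S U) : ℤ) - #U = -1 ↔ #(nbr A S U) + 1 = #U := by lia
  rw [e4]
  refine and_congr_right fun h => and_congr ?_ (e3 h)
  refine forall₂_congr fun J hJ => ?_
  rw [e1 J hJ]
  lia

theorem sum_isLeastViolator_setExcess {V U : Finset ι} (hU : U ⊆ V) (E : Finset α) :
    ∑ S ∈ E.powerset with IsLeastViolator V (setExcess A S) U,
        (X ^ (#E - #S) * (1 - X) ^ (#S + 1 - #V) : ℤ[X]) =
      (#(criticalSets A U E) : ℤ[X]) * X ^ (#(nbr A E U) + 1 - #U) *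
        setPolynomial A (V \ U) (E \ nbr A E U) := by
  have hsplit : ∀ S₁ S₂ : Finset α, S₁ ⊆ nbr A E U → S₂ ⊆ E \ nbr A E U →
      nbr A (S₁ ∪ S₂) U = S₁ ∧ (S₁ ∪ S₂) \ nbr A (S₁ ∪ S₂) U = S₂ := by
    intro S₁ S₂ h1 h2
    have : nbr A (S₁ ∪ S₂) U = S₁ := by
      ext e
      have a1 := @h1 e
      have a2 := @h2 e
      simp only [mem_nbr, mem_union, mem_sdiff] at *
      grind
    refine ⟨this, ?_⟩
    rw [this, union_sdiff_cancel_left]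
    exact disjoint_of_subset_left h1 (disjoint_of_subset_right h2 disjoint_sdiff)
  rw [setPolynomial, mul_assoc, mul_sum, ← nsmul_eq_mul, ← sum_const, ← sum_product']
  refine sum_nbij' (fun S => (nbr A S U, S \ nbr A S U)) (fun p => p.1 ∪ p.2) ?_ ?_ ?_ ?_ ?_
  · intro S hS
    rw [mem_filter, mem_powerset] at hS
    exact mem_product.2 ((isLeastViolator_setExcess_iff A hS.1).1 hS.2)
  · rintro ⟨S₁, S₂⟩ h
    obtain ⟨h1, h2⟩ := mem_product.1 h
    have h1' := ((mem_criticalSets A).1 h1).1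
    have h2' := ((mem_hallSets A).1 h2).1
    have hE : S₁ ∪ S₂ ⊆ E := union_subset (h1'.trans (nbr_subset A _ _)) (h2'.trans sdiff_subset)
    obtain ⟨e1, e2⟩ := hsplit _ _ h1' h2'
    refine mem_filter.2 ⟨mem_powerset.2 hE, (isLeastViolator_setExcess_iff A hE).2 ?_⟩
    rw [e2, e1]
    exact ⟨h1, h2⟩
  · intro S hS
    exact union_sdiff_of_subset (nbr_subset A S U)
  · rintro ⟨S₁, S₂⟩ h
    obtain ⟨h1, h2⟩ := mem_product.1 h
    obtain ⟨e1, e2⟩ := hsplit _ _ ((mem_criticalSets A).1 h1).1 ((mem_hallSets A).1 h2).1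
    exact Prod.ext e1 e2
  · intro S hS
    rw [mem_filter, mem_powerset] at hS
    obtain ⟨h1, h2⟩ := (isLeastViolator_setExcess_iff A hS.1).1 hS.2
    have a1 := ((mem_criticalSets A).1 h1).2.1
    have a2 := card_le_of_mem_hallSets A h2
    have a3 := card_le_card ((mem_hallSets A).1 h2).1
    have a4 := card_sdiff_add_card_eq_card (nbr_subset A S U)
    have a5 := card_sdiff_add_card_eq_card (nbr_subset A E U)
    have a6 := card_sdiff_add_card_eq_card hU
    have a7 := card_le_card ((mem_criticalSets A).1 h1).1
    -- The critical part has `|U| - 1` elements, so it contributes `|N(U)| + 1 - |U|` to the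
    -- exponent of `X`, and the `+ 1` in the exponent of `1 - X` absorbs its missing element.
    rw [← mul_assoc, ← pow_add]
    congr 2 <;> lia

/-- Both sides are the weighted sum over `hallSets A (V.erase i) E \ hallSets A V E`. The weight is
normalized to `V.erase i`, so members of `hallSets A V E` carry an extra factor `1 - X`. -/
theorem setPolynomial_recursion {V : Finset ι} {i : ι} (hi : i ∈ V) (E : Finset α) :
    setPolynomial A (V.erase i) E + (X - 1) * setPolynomial A V E =
      ∑ U ∈ V.powerset with i ∈ U,
        (#(criticalSets A U E) : ℤ[X]) * X ^ (#(nbr A E U) + 1 - #U) *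
        setPolynomial A (V \ U) (E \ nbr A E U) := by
  have h1 : ∑ U ∈ V.powerset with i ∈ U,
        (#(criticalSets A U E) : ℤ[X]) * X ^ (#(nbr A E U) + 1 - #U) *
        setPolynomial A (V \ U) (E \ nbr A E U) =
      ∑ S ∈ E.powerset with IsDeficient V i (setExcess A S),
        (X ^ (#E - #S) * (1 - X) ^ (#S + 1 - #V) : ℤ[X]) := by
    rw [sum_isDeficient _ _ _ _ (setExcess_submodular A)]
    refine sum_congr rfl fun U hU => ?_
    rw [sum_isLeastViolator_setExcess A (mem_powerset.1 (mem_filter.1 hU).1)]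
  have hsub : hallSets A V E ⊆ hallSets A (V.erase i) E := by
    intro S
    simp only [mem_hallSets]
    exact fun ⟨h, h'⟩ => ⟨h, fun J hJ => h' J (hJ.trans (erase_subset _ _))⟩
  have h2 : {S ∈ E.powerset | IsDeficient V i (setExcess A S)} =
      hallSets A (V.erase i) E \ hallSets A V E := by
    ext S
    rw [mem_filter, mem_powerset, mem_sdiff]
    constructor
    · exact fun ⟨h, h'⟩ => (isDeficient_setExcess_iff A h).1 h'
    · intro h
      have hS := ((mem_hallSets A).1 h.1).1
      exact ⟨hS, (isDeficient_setExcess_iff A hS).2 h⟩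
  have h3 : setPolynomial A (V.erase i) E =
      ∑ S ∈ hallSets A (V.erase i) E, (X ^ (#E - #S) * (1 - X) ^ (#S + 1 - #V) : ℤ[X]) := by
    refine sum_congr rfl fun S _ => ?_
    have := card_pos.2 ⟨i, hi⟩
    rw [card_erase_of_mem hi]
    congr 2
    lia
  have h4 : (1 - X) * setPolynomial A V E =
      ∑ S ∈ hallSets A V E, (X ^ (#E - #S) * (1 - X) ^ (#S + 1 - #V) : ℤ[X]) := by
    rw [setPolynomial, mul_sum]
    refine sum_congr rfl fun S hS => ?_
    rw [Nat.sub_add_comm (card_le_of_mem_hallSets A hS), pow_succ]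
    ring
  rw [h1, h2, h3, ← sum_sdiff hsub, ← h4]
  ring

/-- With no conditions left this is the binomial expansion of `((1 - X) + X) ^ #E`. -/
theorem setPolynomial_empty (E : Finset α) : setPolynomial A ∅ E = 1 := by
  have : hallSets A ∅ E = E.powerset := by
    ext S
    simp [mem_hallSets]
  rw [setPolynomial, this]
  have h := sum_pow_mul_eq_add_pow (1 - X : ℤ[X]) X E
  rw [sub_add_cancel, one_pow] at h
  refine Eq.trans ?_ h
  refine sum_congr rfl fun S _ => ?_
  rw [card_empty, Nat.sub_zero, mul_comm]

end Recursion

/-! ### The same recursion for integer vectors -/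

section Vectors

variable {ι α : Type*} (A : ι → Set α)

/-- The slack of `c` at `J`. -/
noncomputable def vectorExcess (E : Finset α) (c : ι → ℕ) (J : Finset ι) : ℤ :=
  #(nbr A E J) - ∑ j ∈ J, (c j : ℤ)

theorem vectorExcess_submodular (E : Finset α) (c : ι → ℕ) (J K : Finset ι) :
    vectorExcess A E c (J ∪ K) + vectorExcess A E c (J ∩ K) ≤
      vectorExcess A E c J + vectorExcess A E c K := by
  have h1 := card_nbr_submodular A E J K
  have h2 := sum_union_inter (s₁ := J) (s₂ := K) (f := fun j => (c j : ℤ))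
  simp only [vectorExcess]
  lia

/-- The vector `c` with the entries outside `U` replaced by `0`. -/
noncomputable def restrict (U : Finset ι) (c : ι → ℕ) : ι → ℕ := fun j => if j ∈ U then c j else 0

theorem sum_restrict {U J : Finset ι} (hJ : J ⊆ U) (c : ι → ℕ) :
    ∑ j ∈ J, restrict U c j = ∑ j ∈ J, c j :=
  sum_congr rfl fun _ hj => if_pos (hJ hj)

theorem sum_update_add [DecidableEq ι] (c : ι → ℕ) (i : ι) (b : ℕ) {J : Finset ι} (hi : i ∈ J) :
    ∑ j ∈ J, Function.update c i b j + c i = ∑ j ∈ J, c j + b := by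
  rw [sum_update_of_mem hi, ← add_sum_erase J c hi, sdiff_singleton_eq_erase]
  ring

variable [Fintype ι]

/-- The integer vectors with entries between `1` and `n` on `V`, and `0` elsewhere. -/
noncomputable def box (V : Finset ι) (n : ℕ) : Finset (ι → ℕ) :=
  Fintype.piFinset fun j => if j ∈ V then Icc 1 n else {0}

theorem mem_box {V : Finset ι} {n : ℕ} {c : ι → ℕ} :
    c ∈ box V n ↔ (∀ j ∈ V, 1 ≤ c j ∧ c j ≤ n) ∧ ∀ j ∉ V, c j = 0 := by
  simp only [box, Fintype.mem_piFinset]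
  constructor
  · intro h
    refine ⟨fun j hj => ?_, fun j hj => ?_⟩ <;> simpa [hj] using h j
  · rintro ⟨h1, h2⟩ j
    by_cases hj : j ∈ V
    · simpa [hj] using h1 j hj
    · simpa [hj] using h2 j hj

/-- The positive integer vectors `c` on `V` with `c(J) ≤ |N(J)|` for all `J ⊆ V`. -/
noncomputable def hallVectors (V : Finset ι) (E : Finset α) : Finset (ι → ℕ) :=
  (box V (#E + 1)).filter fun c => ∀ J ⊆ V, ∑ j ∈ J, c j ≤ #(nbr A E J)

/-- The positive integer vectors `c` on `U` with `c(U) = |N(U)| + 1` and `c(J) ≤ |N(J)|` for all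
proper subsets `J` of `U`. -/
noncomputable def criticalVectors (U : Finset ι) (E : Finset α) : Finset (ι → ℕ) :=
  (box U (#E + 1)).filter fun c =>
    ∑ j ∈ U, c j = #(nbr A E U) + 1 ∧ ∀ J ⊂ U, ∑ j ∈ J, c j ≤ #(nbr A E J)

/-- The generating function of `hallVectors` by degree. -/
noncomputable def vectorPolynomial (V : Finset ι) (E : Finset α) : ℤ[X] :=
  ∑ c ∈ hallVectors A V E, X ^ (∑ j ∈ V, c j - #V)

theorem mem_hallVectors {V : Finset ι} {E : Finset α} {c : ι → ℕ} :
    c ∈ hallVectors A V E ↔ (∀ j ∈ V, 1 ≤ c j) ∧ (∀ j ∉ V, c j = 0) ∧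
      ∀ J ⊆ V, ∑ j ∈ J, c j ≤ #(nbr A E J) := by
  simp only [hallVectors, mem_filter, mem_box]
  constructor
  · rintro ⟨⟨h1, h2⟩, h3⟩
    exact ⟨fun j hj => (h1 j hj).1, h2, h3⟩
  · rintro ⟨h1, h2, h3⟩
    refine ⟨⟨fun j hj => ⟨h1 j hj, ?_⟩, h2⟩, h3⟩
    have h := h3 {j} (by simpa using hj)
    have h' := card_le_card (nbr_subset A E {j})
    rw [sum_singleton] at h
    lia

theorem mem_criticalVectors {U : Finset ι} {E : Finset α} {c : ι → ℕ} :
    c ∈ criticalVectors A U E ↔ (∀ j ∈ U, 1 ≤ c j) ∧ (∀ j ∉ U, c j = 0) ∧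
      ∑ j ∈ U, c j = #(nbr A E U) + 1 ∧ ∀ J ⊂ U, ∑ j ∈ J, c j ≤ #(nbr A E J) := by
  simp only [criticalVectors, mem_filter, mem_box]
  constructor
  · rintro ⟨⟨h1, h2⟩, h3⟩
    exact ⟨fun j hj => (h1 j hj).1, h2, h3⟩
  · rintro ⟨h1, h2, h3⟩
    refine ⟨⟨fun j hj => ⟨h1 j hj, ?_⟩, h2⟩, h3⟩
    have h := single_le_sum (f := c) (fun _ _ => Nat.zero_le _) hj
    have h' := card_le_card (nbr_subset A E U)
    lia

/-- The analogue of `isLeastViolator_setExcess_iff`: the overshoot by one at `U` uses up the slack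
allowed at `J ∪ U`. -/
theorem isLeastViolator_vectorExcess_iff {V U : Finset ι} (hU : U ⊆ V) {E : Finset α} {c : ι → ℕ}
    (hc : c ∈ box V (#E + 1)) :
    IsLeastViolator V (vectorExcess A E c) U ↔
      restrict U c ∈ criticalVectors A U E ∧
        restrict (V \ U) c ∈ hallVectors A (V \ U) (E \ nbr A E U) := by
  rw [mem_box] at hc
  have e1 : ∀ j ∈ U, 1 ≤ restrict U c j := fun j hj => by
    simpa [restrict, hj] using (hc.1 j (hU hj)).1
  have e2 : ∀ j ∉ U, restrict U c j = 0 := fun j hj => if_neg hj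
  have e3 : ∀ j ∈ V \ U, 1 ≤ restrict (V \ U) c j := fun j hj => by
    simp only [restrict, if_pos hj]
    exact (hc.1 j (mem_sdiff.1 hj).1).1
  have e4 : ∀ j ∉ V \ U, restrict (V \ U) c j = 0 := fun j hj => if_neg hj
  rw [mem_criticalVectors, mem_hallVectors, and_iff_right e1, and_iff_right e2, and_iff_right e3,
    and_iff_right e4, sum_restrict subset_rfl]
  simp only [IsLeastViolator, vectorExcess, and_assoc]
  simp only [← Nat.cast_sum]
  have e5 : (#(nbr A E U) : ℤ) - (∑ j ∈ U, c j : ℕ) = -1 ↔ ∑ j ∈ U, c j = #(nbr A E U) + 1 := by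
    lia
  rw [e5]
  refine and_congr_right fun h => and_congr ?_ ?_
  · refine forall₂_congr fun J hJ => ?_
    rw [sum_restrict hJ.1]
    lia
  · refine forall₂_congr fun J hJ => ?_
    rw [card_nbr_union, sum_union (disjoint_of_subset_left hJ sdiff_disjoint), sum_restrict hJ]
    lia

theorem sum_isLeastViolator_vectorExcess {V U : Finset ι} (hU : U ⊆ V) (E : Finset α) :
    ∑ c ∈ box V (#E + 1) with IsLeastViolator V (vectorExcess A E c) U,
        (X ^ (∑ j ∈ V, c j - #V) : ℤ[X]) =
      (#(criticalVectors A U E) : ℤ[X]) * X ^ (#(nbr A E U) + 1 - #U) *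
        vectorPolynomial A (V \ U) (E \ nbr A E U) := by
  rw [vectorPolynomial, mul_assoc, mul_sum, ← nsmul_eq_mul, ← sum_const, ← sum_product']
  have hsplit : ∀ c₁ ∈ criticalVectors A U E, ∀ c₂ ∈ hallVectors A (V \ U) (E \ nbr A E U),
      restrict U (c₁ + c₂) = c₁ ∧ restrict (V \ U) (c₁ + c₂) = c₂ := by
    intro c₁ h1 c₂ h2
    have a1 := ((mem_criticalVectors A).1 h1).2.1
    have a2 := ((mem_hallVectors A).1 h2).2.1
    constructor
    · ext j
      have b1 := a1 j
      have b2 := a2 j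
      simp only [restrict, Pi.add_apply, mem_sdiff] at *
      grind
    · ext j
      have b1 := a1 j
      have b2 := a2 j
      simp only [restrict, Pi.add_apply, mem_sdiff] at *
      grind
  refine sum_nbij' (fun c => (restrict U c, restrict (V \ U) c)) (fun p => p.1 + p.2) ?_ ?_ ?_ ?_ ?_
  · intro c hc
    rw [mem_filter] at hc
    exact mem_product.2 ((isLeastViolator_vectorExcess_iff A hU hc.1).1 hc.2)
  · rintro ⟨c₁, c₂⟩ h
    obtain ⟨h1, h2⟩ := mem_product.1 h
    dsimp only at h1 h2
    obtain ⟨e1, e2⟩ := hsplit c₁ h1 c₂ h2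
    have hb : c₁ + c₂ ∈ box V (#E + 1) := by
      have a1 := mem_box.1 (mem_filter.1 h1).1
      have a2 := mem_box.1 (mem_filter.1 h2).1
      have a3 := card_le_card (sdiff_subset : E \ nbr A E U ⊆ E)
      rw [mem_box]
      constructor
      · intro j hj
        simp only [Pi.add_apply]
        by_cases hjU : j ∈ U
        · rw [a2.2 j (by simp [hjU])]
          exact a1.1 j hjU
        · rw [a1.2 j hjU]
          have := a2.1 j (by simp [hjU, hj])
          lia
      · intro j hj
        rw [Pi.add_apply, a1.2 j (fun h => hj (hU h)), a2.2 j (by simp [hj])]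
    refine mem_filter.2 ⟨hb, (isLeastViolator_vectorExcess_iff A hU hb).2 ?_⟩
    rw [e1, e2]
    exact ⟨h1, h2⟩
  · intro c hc
    have a := (mem_box.1 (mem_filter.1 hc).1).2
    ext j
    have := a j
    have := @hU j
    simp only [restrict, Pi.add_apply, mem_sdiff]
    grind
  · rintro ⟨c₁, c₂⟩ h
    obtain ⟨h1, h2⟩ := mem_product.1 h
    obtain ⟨e1, e2⟩ := hsplit c₁ h1 c₂ h2
    exact Prod.ext e1 e2
  · intro c hc
    rw [mem_filter] at hc
    obtain ⟨h1, h2⟩ := (isLeastViolator_vectorExcess_iff A hU hc.1).1 hc.2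
    have a1 := ((mem_criticalVectors A).1 h1).2.2.1
    have a2 := sum_sdiff (f := c) hU
    have a3 := card_sdiff_add_card_eq_card hU
    have a4 : #(V \ U) • 1 ≤ ∑ j ∈ V \ U, c j :=
      card_nsmul_le_sum _ _ _ fun j hj => ((mem_box.1 hc.1).1 j (mem_sdiff.1 hj).1).1
    have a5 : #U • 1 ≤ ∑ j ∈ U, c j :=
      card_nsmul_le_sum _ _ _ fun j hj => ((mem_box.1 hc.1).1 j (hU hj)).1
    rw [sum_restrict subset_rfl] at a1
    dsimp only
    rw [sum_restrict subset_rfl, ← pow_add]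
    simp only [smul_eq_mul, mul_one] at a4 a5
    congr 1
    lia

/-- The vectors `c` on `V` that become `hallVectors` when the bound `|N(J)|` is relaxed by one
for the sets `J` containing `i`. -/
noncomputable def relaxedVectors (V : Finset ι) (i : ι) (E : Finset α) : Finset (ι → ℕ) :=
  (box V (#E + 1)).filter fun c =>
    (∀ J ⊆ V, i ∉ J → 0 ≤ vectorExcess A E c J) ∧ ∀ J ⊆ V, -1 ≤ vectorExcess A E c J

theorem mem_relaxedVectors {V : Finset ι} {i : ι} {E : Finset α} {c : ι → ℕ} :
    c ∈ relaxedVectors A V i E ↔ c ∈ box V (#E + 1) ∧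
      (∀ J ⊆ V, i ∉ J → ∑ j ∈ J, c j ≤ #(nbr A E J)) ∧
        ∀ J ⊆ V, ∑ j ∈ J, c j ≤ #(nbr A E J) + 1 := by
  simp only [relaxedVectors, mem_filter, vectorExcess, ← Nat.cast_sum]
  refine and_congr_right fun _ => and_congr ?_ ?_
  · exact forall₃_congr fun J _ _ => by lia
  · exact forall₂_congr fun J _ => by lia

theorem update_zero_mem_hallVectors {V : Finset ι} {i : ι} {E : Finset α} {c : ι → ℕ}
    (hc : c ∈ relaxedVectors A V i E) :
    Function.update c i 0 ∈ hallVectors A (V.erase i) E := by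
  obtain ⟨hb, h1, -⟩ := (mem_relaxedVectors A).1 hc
  rw [mem_box] at hb
  refine (mem_hallVectors A).2 ⟨fun j hj => ?_, fun j hj => ?_, fun J hJ => ?_⟩
  · rw [mem_erase] at hj
    rw [Function.update_of_ne hj.1]
    exact (hb.1 j hj.2).1
  · by_cases hji : j = i
    · simp [hji]
    · rw [Function.update_of_ne hji]
      exact hb.2 j fun h => hj (mem_erase.2 ⟨hji, h⟩)
  · obtain ⟨hJV, hiJ⟩ := subset_erase.1 hJ
    rw [sum_update_of_notMem hiJ]
    exact h1 J hJV hiJ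

theorem update_one_mem_relaxedVectors {V : Finset ι} {i : ι} (hi : i ∈ V) {E : Finset α}
    {c : ι → ℕ} (hc : c ∈ hallVectors A (V.erase i) E) :
    Function.update c i 1 ∈ relaxedVectors A V i E := by
  have hb := mem_box.1 (mem_filter.1 hc).1
  have h1 := ((mem_hallVectors A).1 hc).2.2
  refine (mem_relaxedVectors A).2 ⟨mem_box.2 ⟨fun j hj => ?_, fun j hj => ?_⟩,
    fun J hJ hiJ => ?_, fun J hJ => ?_⟩
  · by_cases hji : j = i
    · simp [hji]
    · rw [Function.update_of_ne hji]
      exact hb.1 j (mem_erase.2 ⟨hji, hj⟩)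
  · have hji : j ≠ i := fun h => hj (h ▸ hi)
    rw [Function.update_of_ne hji]
    exact hb.2 j fun h => hj (mem_of_mem_erase h)
  · rw [sum_update_of_notMem hiJ]
    exact h1 J (subset_erase.2 ⟨hJ, hiJ⟩)
  · by_cases hiJ : i ∈ J
    · have h2 := h1 (J.erase i) (erase_subset_erase _ hJ)
      have h3 := card_le_card (nbr_mono A (subset_refl E) (erase_subset i J))
      rw [sum_update_of_mem hiJ, sdiff_singleton_eq_erase]
      lia
    · rw [sum_update_of_notMem hiJ]
      exact (h1 J (subset_erase.2 ⟨hJ, hiJ⟩)).trans (Nat.le_succ _)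

theorem update_pred_mem_hallVectors {V : Finset ι} {i : ι} (hi : i ∈ V) {E : Finset α}
    {c : ι → ℕ} (hc : c ∈ relaxedVectors A V i E) (hci : c i ≠ 1) :
    Function.update c i (c i - 1) ∈ hallVectors A V E := by
  obtain ⟨hb, h1, h2⟩ := (mem_relaxedVectors A).1 hc
  rw [mem_box] at hb
  have hpos := (hb.1 i hi).1
  refine (mem_hallVectors A).2 ⟨fun j hj => ?_, fun j hj => ?_, fun J hJ => ?_⟩
  · by_cases hji : j = i
    · subst hji
      rw [Function.update_self]
      lia
    · rw [Function.update_of_ne hji]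
      exact (hb.1 j hj).1
  · have hji : j ≠ i := fun h => hj (h ▸ hi)
    rw [Function.update_of_ne hji]
    exact hb.2 j hj
  · by_cases hiJ : i ∈ J
    · have := sum_update_add c i (c i - 1) hiJ
      have := h2 J hJ
      lia
    · rw [sum_update_of_notMem hiJ]
      exact h1 J hJ hiJ

theorem update_succ_mem_relaxedVectors {V : Finset ι} {i : ι} (hi : i ∈ V) {E : Finset α}
    {c : ι → ℕ} (hc : c ∈ hallVectors A V E) :
    Function.update c i (c i + 1) ∈ relaxedVectors A V i E := by
  have hb := mem_box.1 (mem_filter.1 hc).1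
  have h1 := ((mem_hallVectors A).1 hc).2.2
  -- After raising the entry by one it is at most `#E + 1`, which is why the box has this size.
  have hle : c i ≤ #E := by
    have h := h1 {i} (by simpa using hi)
    rw [sum_singleton] at h
    exact h.trans (card_le_card (nbr_subset A E {i}))
  refine (mem_relaxedVectors A).2 ⟨mem_box.2 ⟨fun j hj => ?_, fun j hj => ?_⟩,
    fun J hJ hiJ => ?_, fun J hJ => ?_⟩
  · by_cases hji : j = i
    · subst hji
      rw [Function.update_self]
      lia
    · rw [Function.update_of_ne hji]
      exact hb.1 j hj
  · have hji : j ≠ i := fun h => hj (h ▸ hi)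
    rw [Function.update_of_ne hji]
    exact hb.2 j hj
  · rw [sum_update_of_notMem hiJ]
    exact h1 J hJ
  · have := h1 J hJ
    by_cases hiJ : i ∈ J
    · have := sum_update_add c i (c i + 1) hiJ
      lia
    · rw [sum_update_of_notMem hiJ]
      lia

/-- If `c i = 1`, deleting the entry leaves a good vector on `V.erase i` of the same degree.
Otherwise lowering `c i` by one removes the relaxation and costs one factor `X`. -/
theorem sum_relaxedVectors {V : Finset ι} {i : ι} (hi : i ∈ V) (E : Finset α) :
    ∑ c ∈ relaxedVectors A V i E, (X ^ (∑ j ∈ V, c j - #V) : ℤ[X]) =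
      vectorPolynomial A (V.erase i) E + X * vectorPolynomial A V E := by
  rw [← sum_filter_add_sum_filter_not _ (fun c => c i = 1)]
  congr 1
  · refine sum_nbij' (fun c => Function.update c i 0) (fun c => Function.update c i 1) ?_ ?_ ?_ ?_ ?_
    · exact fun c hc => update_zero_mem_hallVectors A (mem_filter.1 hc).1
    · exact fun c hc => mem_filter.2 ⟨update_one_mem_relaxedVectors A hi hc, by simp⟩
    · intro c hc
      simp [← (mem_filter.1 hc).2]
    · intro c hc
      have := ((mem_hallVectors A).1 hc).2.1 i (by simp)
      simp [← this]
    · intro c hc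
      have h1 := (mem_filter.1 hc).2
      have h2 := add_sum_erase V c hi
      have h3 := card_pos.2 ⟨i, hi⟩
      rw [sum_update_of_notMem (by simp), card_erase_of_mem hi]
      congr 1
      lia
  · rw [vectorPolynomial, mul_sum]
    refine sum_nbij' (fun c => Function.update c i (c i - 1)) (fun c => Function.update c i (c i + 1))
      ?_ ?_ ?_ ?_ ?_
    · exact fun c hc => update_pred_mem_hallVectors A hi (mem_filter.1 hc).1 (mem_filter.1 hc).2
    · intro c hc
      have := ((mem_hallVectors A).1 hc).1 i hi
      refine mem_filter.2 ⟨update_succ_mem_relaxedVectors A hi hc, ?_⟩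
      rw [Function.update_self]
      lia
    · intro c hc
      have h1 := mem_box.1 ((mem_relaxedVectors A).1 (mem_filter.1 hc).1).1
      have h2 := (h1.1 i hi).1
      simp [Nat.sub_add_cancel h2]
    · intro c hc
      simp
    · intro c hc
      have hc' := update_pred_mem_hallVectors A hi (mem_filter.1 hc).1 (mem_filter.1 hc).2
      have h1 : #V • 1 ≤ ∑ j ∈ V, Function.update c i (c i - 1) j :=
        card_nsmul_le_sum _ _ _ ((mem_hallVectors A).1 hc').1
      have h2 := (mem_box.1 ((mem_relaxedVectors A).1 (mem_filter.1 hc).1).1).1 i hi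
      have h3 := sum_update_add c i (c i - 1) hi
      rw [← pow_succ']
      simp only [smul_eq_mul, mul_one] at h1
      congr 1
      lia

/-- Deficient vectors are the relaxed ones that are not good, so their sum is that of
`sum_relaxedVectors` minus `vectorPolynomial A V E`. -/
theorem vectorPolynomial_recursion {V : Finset ι} {i : ι} (hi : i ∈ V) (E : Finset α) :
    vectorPolynomial A (V.erase i) E + (X - 1) * vectorPolynomial A V E =
      ∑ U ∈ V.powerset with i ∈ U,
        (#(criticalVectors A U E) : ℤ[X]) * X ^ (#(nbr A E U) + 1 - #U) *
        vectorPolynomial A (V \ U) (E \ nbr A E U) := by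
  have h1 : ∑ U ∈ V.powerset with i ∈ U, (#(criticalVectors A U E) : ℤ[X]) *
        X ^ (#(nbr A E U) + 1 - #U) * vectorPolynomial A (V \ U) (E \ nbr A E U) =
      ∑ c ∈ box V (#E + 1) with IsDeficient V i (vectorExcess A E c),
        (X ^ (∑ j ∈ V, c j - #V) : ℤ[X]) := by
    rw [sum_isDeficient _ _ _ _ (vectorExcess_submodular A E)]
    refine sum_congr rfl fun U hU => ?_
    rw [sum_isLeastViolator_vectorExcess A (mem_powerset.1 (mem_filter.1 hU).1)]
  have hhall : ∀ c, (∀ J ⊆ V, ∑ j ∈ J, c j ≤ #(nbr A E J)) ↔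
      ∀ J ⊆ V, 0 ≤ vectorExcess A E c J := by
    intro c
    refine forall₂_congr fun J hJ => ?_
    rw [vectorExcess, ← Nat.cast_sum]
    lia
  have hsub : hallVectors A V E ⊆ relaxedVectors A V i E := by
    intro c hc
    simp only [hallVectors, relaxedVectors, mem_filter, hhall] at hc ⊢
    exact ⟨hc.1, fun J hJ _ => hc.2 J hJ, fun J hJ => by linarith [hc.2 J hJ]⟩
  have h2 : {c ∈ box V (#E + 1) | IsDeficient V i (vectorExcess A E c)} =
      relaxedVectors A V i E \ hallVectors A V E := by
    ext c
    rw [mem_filter, mem_sdiff, hallVectors, relaxedVectors, mem_filter, mem_filter, hhall,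
      IsDeficient]
    push Not
    tauto
  have h3 := sum_sdiff (f := fun c => (X ^ (∑ j ∈ V, c j - #V) : ℤ[X])) hsub
  rw [sum_relaxedVectors A hi] at h3
  rw [h1, h2]
  rw [← vectorPolynomial] at h3
  linear_combination -h3

end Vectors

/-! ### Equality of the two generating functions -/

section Equality

variable {ι α : Type*} [Fintype ι] (A : ι → Set α)

theorem vectorPolynomial_empty (E : Finset α) : vectorPolynomial A ∅ E = 1 := by
  have : hallVectors A ∅ E = {0} := by
    ext c
    simp [mem_hallVectors, funext_iff]
  rw [vectorPolynomial, this]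
  simp

/-- The two claims are proved together: the recursion at `V` involves the polynomials on smaller
index sets and the critical counts for all `U ⊆ V` containing `i`. -/
theorem card_criticalSets_and_setPolynomial_eq (n : ℕ) : ∀ (V : Finset ι) (E : Finset α), #V = n →
    (V.Nonempty → #(criticalSets A V E) = #(criticalVectors A V E)) ∧
      setPolynomial A V E = vectorPolynomial A V E := by
  induction n using Nat.strong_induction_on with
  | _ n ih =>
    intro V E hn
    obtain rfl | ⟨i, hi⟩ := V.eq_empty_or_nonempty
    · simp [setPolynomial_empty, vectorPolynomial_empty]
    have hs := setPolynomial_recursion A hi E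
    have hv := vectorPolynomial_recursion A hi E
    have hV : V ∈ V.powerset.filter (fun U => i ∈ U) := by simp [hi]
    -- Isolate `U = V`, the only term on the right not covered by induction.
    rw [← add_sum_erase _ _ hV, sdiff_self, bot_eq_empty] at hs hv
    have herase : setPolynomial A (V.erase i) E = vectorPolynomial A (V.erase i) E :=
      (ih _ (hn ▸ card_erase_lt_of_mem hi) _ _ rfl).2
    have hrest : ∀ U ∈ (V.powerset.filter (fun U => i ∈ U)).erase V,
        (#(criticalSets A U E) : ℤ[X]) * X ^ (#(nbr A E U) + 1 - #U) *
          setPolynomial A (V \ U) (E \ nbr A E U) =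
        (#(criticalVectors A U E) : ℤ[X]) * X ^ (#(nbr A E U) + 1 - #U) *
          vectorPolynomial A (V \ U) (E \ nbr A E U) := by
      intro U hU
      rw [mem_erase, mem_filter, mem_powerset] at hU
      obtain ⟨hne, hUV, hiU⟩ := hU
      have h1 : #U < n := hn ▸ card_lt_card (hUV.ssubset_of_ne hne)
      have h2 : #(V \ U) < n := hn ▸ card_lt_card (sdiff_ssubset hUV ⟨i, hiU⟩)
      rw [(ih _ h1 U E rfl).1 ⟨i, hiU⟩, (ih _ h2 _ _ rfl).2]
    rw [sum_congr rfl hrest, setPolynomial_empty, herase] at hs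
    rw [vectorPolynomial_empty] at hv
    have key : (X - 1) * (setPolynomial A V E - vectorPolynomial A V E) =
        ((#(criticalSets A V E) : ℤ[X]) - (#(criticalVectors A V E) : ℤ[X])) *
          X ^ (#(nbr A E V) + 1 - #V) := by
      linear_combination hs - hv
    have h1 : #(criticalSets A V E) = #(criticalVectors A V E) := by
      -- At `1` the factor `X - 1` vanishes and the power of `X` becomes `1`, so the critical counts
      -- agree.
      have := congrArg (eval 1) key
      simp at this
      lia
    refine ⟨fun _ => h1, ?_⟩
    rw [h1, sub_self, zero_mul, mul_eq_zero] at key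
    rcases key with h | h
    · exact absurd h (X_sub_C_ne_zero (1 : ℤ))
    · exact sub_eq_zero.1 h

theorem setPolynomial_eq_vectorPolynomial (V : Finset ι) (E : Finset α) :
    setPolynomial A V E = vectorPolynomial A V E :=
  (card_criticalSets_and_setPolynomial_eq A _ V E rfl).2

end Equality

/-! ### Presentations, spanning sets and the `h`-polynomial -/

section Presentation

variable {α : Type*}

theorem biUnion_nbr_singleton {ι : Type*} (A : ι → Set α) (S : Finset α) (J : Finset ι) :
    (J.biUnion fun j => nbr A S {j}) = nbr A S J := by
  ext e
  simp only [mem_biUnion, mem_nbr, mem_singleton]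
  grind

/-- Hall's marriage theorem in terms of `nbr`. -/
theorem forall_card_le_card_nbr_iff {ι : Type*} (A : ι → Set α) (S : Finset α) :
    (∀ J : Finset ι, #J ≤ #(nbr A S J)) ↔
      ∃ g : ι → α, Function.Injective g ∧ ∀ j, g j ∈ S ∧ g j ∈ A j := by
  have h := all_card_le_biUnion_card_iff_exists_injective fun j => nbr A S {j}
  simp only [biUnion_nbr_singleton] at h
  rw [h]
  simp [mem_nbr]

/-- A matched set of indices gives an independent set. -/
theorem IsPresentation.indep_range {N : Matroid α} {m : ℕ} {A : Fin m → Set α}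
    (hA : IsPresentation N A) {κ : Type*} {g : κ → α} {f : κ → Fin m}
    (hf : Function.Injective f) (h : ∀ k, g k ∈ A (f k)) : N.Indep (Set.range g) := by
  rw [hA.2]
  refine ⟨fun e => f e.2.choose, fun e e' he => ?_, fun e => ?_⟩
  · have h1 := hf he
    rw [Subtype.ext_iff, ← e.2.choose_spec, h1, e'.2.choose_spec]
  · have := h e.2.choose
    rwa [e.2.choose_spec] at this

/-- A base has as many elements as there are presenting sets, so its matching is a bijection and can
be inverted to a transversal. Conversely a full transversal is independent of size `r`, hence a
base. -/
theorem IsPresentation.spanning_iff {N : Matroid α} {r : ℕ} {A : Fin r → Set α}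
    (hA : IsPresentation N A) (hr : N.eRank = r) {S : Finset α} (hS : (S : Set α) ⊆ N.E) :
    N.Spanning (S : Set α) ↔ ∀ J : Finset (Fin r), #J ≤ #(nbr A S J) := by
  rw [forall_card_le_card_nbr_iff]
  constructor
  · intro h
    obtain ⟨B, hB, hBS⟩ := h.exists_isBase_subset
    obtain ⟨f, hf, hfA⟩ := (hA.2 B).1 hB.indep
    have hfin : B.Finite := S.finite_toSet.subset hBS
    have hcard : B.encard = r := by rw [hB.encard_eq_eRank, hr]
    have : Fintype B := hfin.fintype
    have hbij : Function.Bijective f := by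
      rw [Fintype.bijective_iff_injective_and_card]
      refine ⟨hf, ?_⟩
      rw [Set.encard_eq_coe_toFinset_card, Nat.cast_inj, Set.toFinset_card] at hcard
      simpa using hcard
    let F := Equiv.ofBijective f hbij
    refine ⟨fun j => F.symm j, Subtype.val_injective.comp F.symm.injective,
      fun j => ⟨hBS (F.symm j).2, ?_⟩⟩
    have := hfA (F.symm j)
    rwa [show f (F.symm j) = j from F.apply_symm_apply j] at this
  · rintro ⟨g, hg, hgS⟩
    have hI : N.Indep (Set.range g) :=
      hA.indep_range Function.injective_id fun k => (hgS k).2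
    have hB : N.IsBase (Set.range g) := by
      refine hI.isBase_of_eRk_ge (Set.finite_range g) ?_
      rw [hI.eRk_eq_encard, hr, ← Set.image_univ, hg.encard_image]
      simp
    exact hB.spanning_of_superset (by rintro _ ⟨j, rfl⟩; exact (hgS j).1) hS

/-- A transversal matroid of rank `r` has a presentation with `r` members. -/
theorem IsPresentation.exists_of_eRank_eq {N : Matroid α} [N.Finite] {m r : ℕ}
    {A : Fin m → Set α} (hA : IsPresentation N A) (hr : N.eRank = r) :
    ∃ A' : Fin r → Set α, IsPresentation N A' := by
  obtain ⟨B, hB⟩ := N.exists_isBase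
  obtain ⟨f, hf, hfA⟩ := (hA.2 B).1 hB.indep
  have : Fintype B := (N.ground_finite.subset hB.subset_ground).fintype
  have hcard : Fintype.card B = r := by
    have h : B.encard = r := by rw [hB.encard_eq_eRank, hr]
    rwa [Set.encard_eq_coe_toFinset_card, Nat.cast_inj, Set.toFinset_card] at h
  let F : Fin r ≃ B := (Fintype.equivFinOfCardEq hcard).symm
  have hfF : Function.Injective (fun j => f (F j)) := hf.comp F.injective
  -- Keep only the sets to which a base `B` is matched.
  refine ⟨fun j => A (f (F j)), fun j => hA.1 _, fun I => ⟨fun hI => ?_, ?_⟩⟩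
  · obtain ⟨g, hg, hgA⟩ := (hA.2 I).1 hI
    have : Fintype I := (N.ground_finite.subset hI.subset_ground).fintype
    let t : I → Finset (Fin r) := fun e => univ.filter fun j => (e : α) ∈ A (f (F j))
    have hall : ∀ Z : Finset I, #Z ≤ #(Z.biUnion t) := by
      intro Z
      by_contra! hlt
      -- If `Z` violates Hall's condition, join it, matched by `g`, to the base elements indexed by
      -- the sets that `Z` misses, matched by `f`. Elements and indices stay distinct since no
      -- element of `Z` lies in a set indexed by `J`. The result is independent of size `|Z| + |J| >
      -- r`.
      let J : Finset (Fin r) := (Z.biUnion t)ᶜ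
      have hJ : ∀ e ∈ Z, ∀ j ∈ J, (e : α) ∉ A (f (F j)) := by
        intro e he j hj hmem
        refine mem_compl.1 hj (mem_biUnion.2 ⟨e, he, ?_⟩)
        simpa [t] using hmem
      let p : Z ⊕ J → α := Sum.elim (fun e => (e.1 : α)) (fun j => (F j.1 : α))
      let q : Z ⊕ J → Fin m := Sum.elim (fun e => g e.1) (fun j => f (F j.1))
      have hp : Function.Injective p := by
        refine Function.Injective.sumElim ?_ ?_ ?_
        · exact Subtype.val_injective.comp Subtype.val_injective
        · exact Subtype.val_injective.comp (F.injective.comp Subtype.val_injective)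
        · intro e j h
          refine hJ e.1 e.2 j.1 j.2 ?_
          rw [h]
          exact hfA _
      have hq : Function.Injective q := by
        refine Function.Injective.sumElim ?_ ?_ ?_
        · exact hg.comp Subtype.val_injective
        · exact hfF.comp Subtype.val_injective
        · intro e j h
          refine hJ e.1 e.2 j.1 j.2 ?_
          rw [← h]
          exact hgA _
      have hind : N.Indep (Set.range p) := by
        refine hA.indep_range hq ?_
        rintro (e | j)
        · exact hgA _
        · exact hfA _
      have hle := hind.encard_le_eRank
      rw [hr, ← Set.image_univ, hp.encard_image, Set.encard_univ, ENat.card_eq_coe_fintype_card,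
        Nat.cast_le, Fintype.card_sum, Fintype.card_coe, Fintype.card_coe, card_compl,
        Fintype.card_fin] at hle
      have h1 := card_le_univ (Z.biUnion t)
      rw [Fintype.card_fin] at h1
      lia
    obtain ⟨k, hk, hkt⟩ := (all_card_le_biUnion_card_iff_exists_injective t).1 hall
    exact ⟨k, hk, fun e => by simpa [t] using hkt e⟩
  · rintro ⟨k, hk, hkA⟩
    exact (hA.2 I).2 ⟨fun e => f (F (k e)), hfF.comp hk, hkA⟩

/-- Complementation turns independent sets of `M` into spanning sets of the dual; as `d + r = |E|`,
the exponent `d - |I|` is `|S| - r` for `S = E \ I`. -/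
theorem hPolynomial_eq_setPolynomial (M : Matroid α) [M.Finite] {r : ℕ} {A : Fin r → Set α}
    (hA : IsPresentation (Matroid.dual M) A) (hr : (Matroid.dual M).eRank = r) :
    hPolynomial M = setPolynomial A univ M.ground_finite.toFinset := by
  set E := M.ground_finite.toFinset with hE
  have hEM : (E : Set α) = M.E := by simp [hE]
  have hrank : M.eRank.toNat + r = #E := by
    have h := M.eRank_add_eRank_dual
    have h1 : M.eRank ≠ ⊤ := by
      intro h1
      rw [h1, ← hEM, Set.encard_coe_eq_coe_finsetCard, top_add] at h
      exact ENat.top_ne_natCast _ h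
    rw [hr, ← hEM, Set.encard_coe_eq_coe_finsetCard, ← ENat.natCast_toNat h1] at h
    exact_mod_cast h
  have hmem : ∀ S : Finset α, S ∈ hallSets A univ E ↔ S ⊆ E ∧ M.Indep (M.E \ S) := by
    intro S
    rw [mem_hallSets]
    refine and_congr_right fun hS => ?_
    have hS' : (S : Set α) ⊆ M✶.E := by
      rw [Matroid.dual_ground, ← hEM]
      exact_mod_cast hS
    have h := hA.spanning_iff hr hS'
    rw [Matroid.spanning_iff_compl_coindep hS', Matroid.dual_coindep_iff,
      Matroid.dual_ground] at h
    rw [h]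
    simp
  have hcount : ∀ i, indepCount M i = #{S ∈ hallSets A univ E | #E - #S = i} := by
    intro i
    rw [indepCount, ← Set.ncard_coe_finset]
    symm
    refine Set.ncard_congr (fun S _ => M.E \ (S : Set α)) ?_ ?_ ?_
    · intro S hS
      rw [mem_coe, mem_filter, hmem] at hS
      refine ⟨hS.1.2, ?_⟩
      rw [← hEM, ← coe_sdiff, Set.encard_coe_eq_coe_finsetCard, card_sdiff_of_subset hS.1.1, hS.2]
    · intro S T hS hT h
      rw [mem_coe, mem_filter, hmem] at hS hT
      rw [← hEM, ← coe_sdiff, ← coe_sdiff, coe_inj] at h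
      rw [← Finset.sdiff_sdiff_eq_self hS.1.1, h, Finset.sdiff_sdiff_eq_self hT.1.1]
    · rintro I ⟨hI, hcard⟩
      have hIE := hI.subset_ground
      have hIfin := M.ground_finite.subset hIE
      lift I to Finset α using hIfin
      rw [Set.encard_coe_eq_coe_finsetCard, Nat.cast_inj] at hcard
      have hIE' : I ⊆ E := by rw [← hEM] at hIE; exact_mod_cast hIE
      have hback : M.E \ ((E \ I : Finset α) : Set α) = I := by
        rw [← hEM, ← coe_sdiff, Finset.sdiff_sdiff_eq_self hIE']
      refine ⟨E \ I, ?_, hback⟩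
      rw [mem_coe, mem_filter, hmem, hback, card_sdiff_of_subset hIE']
      refine ⟨⟨sdiff_subset, hI⟩, ?_⟩
      have := card_le_card hIE'
      lia
  have hbounds : ∀ S ∈ hallSets A univ E, r ≤ #S ∧ #S ≤ #E := by
    intro S hS
    have h := card_le_of_mem_hallSets A hS
    rw [card_univ, Fintype.card_fin] at h
    exact ⟨h, card_le_card ((mem_hallSets A).1 hS).1⟩
  rw [setPolynomial, hPolynomial,
    ← sum_fiberwise_of_maps_to (g := fun S => #E - #S) (t := range (M.eRank.toNat + 1))]
  · refine sum_congr rfl fun i _ => ?_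
    rw [hcount]
    have : ∀ S ∈ (hallSets A univ E).filter (fun S => #E - #S = i),
        (X ^ (#E - #S) * (1 - X) ^ (#S - #(univ : Finset (Fin r))) : ℤ[X]) =
          X ^ i * (1 - X) ^ (M.eRank.toNat - i) := by
      intro S hS
      rw [mem_filter] at hS
      have h := hbounds S hS.1
      rw [hS.2, card_univ, Fintype.card_fin]
      congr 2
      lia
    rw [sum_congr rfl this, sum_const, nsmul_eq_mul, mul_assoc]
    simp
  · intro S hS
    have h := hbounds S hS
    rw [mem_range]
    lia

end Presentation

/-! ### Lattice points of the transversalhedron and purity -/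

section Polytope

variable {α : Type*} {r : ℕ}

/-- The simplex `Δ_{{0} ∪ I}` lies in the region cut out by `0 ≤ x` and `x(J) ≤ [I ∩ J ≠ ∅]`. -/
theorem simplexWithOrigin_bounds {I : Finset (Fin r)} {x : Fin r → ℝ}
    (hx : x ∈ simplexWithOrigin I) :
    (∀ i, 0 ≤ x i) ∧ ∀ J : Finset (Fin r), ∑ j ∈ J, x j ≤ if (I ∩ J).Nonempty then 1 else 0 := by
  let K : Set (Fin r → ℝ) := {x | (∀ i, 0 ≤ x i) ∧
    ∀ J : Finset (Fin r), ∑ j ∈ J, x j ≤ if (I ∩ J).Nonempty then 1 else 0}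
  have hconv : Convex ℝ K := by
    intro x hx y hy a b ha hb hab
    refine ⟨fun i => ?_, fun J => ?_⟩
    · have := hx.1 i
      have := hy.1 i
      simp only [Pi.add_apply, Pi.smul_apply, smul_eq_mul]
      positivity
    · have h1 := mul_le_mul_of_nonneg_left (hx.2 J) ha
      have h2 := mul_le_mul_of_nonneg_left (hy.2 J) hb
      simp only [Pi.add_apply, Pi.smul_apply, smul_eq_mul, sum_add_distrib, ← mul_sum]
      refine (add_le_add h1 h2).trans ?_
      rw [← add_mul, hab, one_mul]
  refine convexHull_min (t := K) ?_ hconv hx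
  rintro _ (rfl | ⟨i, hi, rfl⟩)
  · refine ⟨fun i => le_rfl, fun J => ?_⟩
    simp only [Pi.zero_apply, sum_const_zero]
    split_ifs <;> norm_num
  · refine ⟨fun j => ?_, fun J => ?_⟩
    · exact (Pi.single_nonneg (α := fun _ : Fin r => ℝ)).2 zero_le_one j
    · simp only [Pi.single_apply, sum_ite_eq']
      split_ifs with h1 h2 h2
      · exact le_rfl
      · exact absurd ⟨i, mem_inter.2 ⟨hi, h1⟩⟩ h2
      · exact zero_le_one
      · exact le_rfl

theorem sum_mem_card_smul {β F : Type*} [AddCommGroup F] [Module ℝ F] {K : Set F}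
    (hK : Convex ℝ K) (hne : K.Nonempty) (s : Finset β) (v : β → F) (hv : ∀ e ∈ s, v e ∈ K) :
    ∑ e ∈ s, v e ∈ (#s : ℝ) • K := by
  induction s using Finset.induction_on with
  | empty => simp [Set.zero_smul_set hne]
  | insert a s ha ih =>
    rw [sum_insert ha, card_insert_of_notMem ha, Nat.cast_add, Nat.cast_one, add_comm (v a),
      hK.add_smul (Nat.cast_nonneg _) zero_le_one, one_smul]
    exact Set.add_mem_add (ih fun e he => hv e (mem_insert_of_mem he)) (hv a (mem_insert_self a s))

/-- The type `{j | e ∈ A j}` of an element. -/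
noncomputable def elementType (A : Fin r → Set α) (e : α) : Finset (Fin r) :=
  univ.filter fun j => e ∈ A j

theorem typeCount_eq (E : Finset α) (A : Fin r → Set α) (I : Finset (Fin r)) :
    typeCount (E : Set α) A I = #{e ∈ E | elementType A e = I} := by
  rw [typeCount, ← Set.ncard_coe_finset]
  congr 1
  ext e
  simp only [Set.mem_ofPred_eq, coe_filter, mem_coe, elementType, Finset.ext_iff, mem_filter,
    mem_univ, true_and]
  exact and_congr_right fun _ => forall_congr' fun j => Iff.comm

/-- An element lies in `N(J)` exactly when its type meets `J`; this adds the simplex bounds up to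
`|N(J)|`. -/
theorem sum_typeCount (E : Finset α) (A : Fin r → Set α) (J : Finset (Fin r)) :
    ∑ I : Finset (Fin r), typeCount (E : Set α) A I * (if (I ∩ J).Nonempty then 1 else 0) =
      #(nbr A E J) := by
  rw [card_eq_sum_card_fiberwise (f := elementType A) (t := univ) (by simp)]
  refine sum_congr rfl fun I _ => ?_
  rw [typeCount_eq]
  split_ifs with h
  · rw [mul_one]
    congr 1
    ext e
    simp only [mem_filter, mem_nbr]
    refine ⟨fun he => ⟨⟨he.1, ?_⟩, he.2⟩, fun he => ⟨he.1.1, he.2⟩⟩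
    obtain ⟨j, hj⟩ := h
    rw [mem_inter, ← he.2] at hj
    exact ⟨j, hj.2, by simpa [elementType] using hj.1⟩
  · rw [mul_zero, eq_comm, card_eq_zero, filter_eq_empty_iff]
    rintro e he rfl
    obtain ⟨-, j, hj, he⟩ := (mem_nbr A).1 he
    exact h ⟨j, by simp [elementType, hj, he]⟩

theorem transversalhedron_bounds {E : Finset α} {A : Fin r → Set α} {x : Fin r → ℝ}
    (hx : x ∈ transversalhedron (E : Set α) A) :
    (∀ i, 0 ≤ x i) ∧ ∀ J : Finset (Fin r), ∑ j ∈ J, x j ≤ #(nbr A E J) := by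
  rw [transversalhedron, Set.mem_finsetSum] at hx
  obtain ⟨g, hg, rfl⟩ := hx
  have hg' : ∀ I : Finset (Fin r), ∃ y ∈ simplexWithOrigin I,
      (typeCount (E : Set α) A I : ℝ) • y = g I := fun I => hg (mem_univ I)
  choose y hy hyg using hg'
  simp only [← hyg]
  constructor
  · intro i
    rw [Finset.sum_apply]
    refine sum_nonneg fun I _ => ?_
    exact mul_nonneg (Nat.cast_nonneg _) ((simplexWithOrigin_bounds (hy I)).1 i)
  · intro J
    rw [← sum_typeCount, Nat.cast_sum]
    simp only [Finset.sum_apply]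
    rw [sum_comm]
    refine sum_le_sum fun I _ => ?_
    simp only [Pi.smul_apply, smul_eq_mul]
    rw [← mul_sum]
    push_cast
    exact mul_le_mul_of_nonneg_left ((simplexWithOrigin_bounds (hy I)).2 J) (Nat.cast_nonneg _)

/-- Take `c j` copies of each index `j`. Hall's theorem matches all copies to distinct elements of
`E`. A matched element contributes the unit vector of its index and an unmatched one contributes
`0`; both lie in the simplex of the element's type, so grouping by type gives a point of the
Minkowski sum. -/
theorem mem_transversalhedron_of_forall_le {E : Finset α} {A : Fin r → Set α} {c : Fin r → ℕ}
    (hc : ∀ J : Finset (Fin r), ∑ j ∈ J, c j ≤ #(nbr A E J)) :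
    (fun i => (c i : ℝ)) ∈ transversalhedron (E : Set α) A := by
  have hall : ∀ K : Finset (Σ j, Fin (c j)), #K ≤ #(K.biUnion fun p => nbr A E {p.1}) := by
    intro K
    have h1 : (K.biUnion fun p => nbr A E {p.1}) = nbr A E (K.image Sigma.fst) := by
      rw [← biUnion_nbr_singleton, image_biUnion]
    have h2 : K ⊆ (K.image Sigma.fst).sigma fun _ => univ := by
      intro p hp
      simpa using ⟨p.2, hp⟩
    rw [h1]
    refine (card_le_card h2).trans ?_
    rw [card_sigma]
    simpa using hc (K.image Sigma.fst)
  obtain ⟨g, hg, hgA⟩ := (all_card_le_biUnion_card_iff_exists_injective _).1 hall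
  simp only [mem_nbr, mem_singleton, exists_eq_left] at hgA
  let v : α → Fin r → ℝ := fun e =>
    if h : ∃ p, g p = e then Pi.single h.choose.1 1 else 0
  have hvg : ∀ p, v (g p) = Pi.single p.1 1 := by
    intro p
    have h : ∃ q, g q = g p := ⟨p, rfl⟩
    simp only [v, dif_pos h]
    rw [hg h.choose_spec]
  have hv : ∀ e, v e ∈ simplexWithOrigin (elementType A e) := by
    intro e
    by_cases h : ∃ p, g p = e
    · obtain ⟨p, rfl⟩ := h
      rw [hvg]
      refine subset_convexHull ℝ _ (Or.inr ⟨p.1, ?_, rfl⟩)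
      simpa [elementType] using (hgA p).2
    · simp only [v, dif_neg h]
      exact subset_convexHull ℝ _ (Or.inl rfl)
  have hsum : (fun i => (c i : ℝ)) = ∑ e ∈ E, v e := by
    have h1 : ∑ e ∈ univ.image g, v e = ∑ e ∈ E, v e := by
      refine sum_subset ?_ ?_
      · intro e he
        obtain ⟨p, -, rfl⟩ := mem_image.1 he
        exact (hgA p).1
      · intro e _ he
        simp only [v]
        rw [dif_neg]
        rintro ⟨p, rfl⟩
        exact he (mem_image_of_mem _ (mem_univ _))
    rw [← h1, sum_image (fun p _ q _ h => hg h)]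
    simp only [hvg]
    rw [← univ_sigma_univ, sum_sigma]
    ext i
    simp [Finset.sum_apply, Pi.single_apply]
  rw [hsum, ← sum_fiberwise E (elementType A) v, transversalhedron]
  refine Set.finsetSum_mem_finsetSum _ _ _ fun I _ => ?_
  rw [typeCount_eq]
  have hconv : Convex ℝ (simplexWithOrigin I) := convex_convexHull ℝ _
  have h0 : (0 : Fin r → ℝ) ∈ simplexWithOrigin I := subset_convexHull ℝ _ (Or.inl rfl)
  refine sum_mem_card_smul hconv ⟨0, h0⟩ _ _ ?_
  intro e he
  rw [← (mem_filter.1 he).2]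
  exact hv e

theorem mem_latticeMonomials_iff {E : Finset α} {A : Fin r → Set α} {m : Fin r →₀ ℕ} :
    m ∈ latticeMonomials (transversalhedron (E : Set α) A) ↔
      ∀ J : Finset (Fin r), ∑ j ∈ J, (m j + 1) ≤ #(nbr A E J) := by
  constructor
  · rintro ⟨c, hc, -, hm⟩ J
    have h := (transversalhedron_bounds hc).2 J
    have h' : ∑ j ∈ J, (c j : ℝ) = ((∑ j ∈ J, (m j + 1) : ℕ) : ℝ) := by
      rw [Nat.cast_sum]
      refine sum_congr rfl fun j _ => ?_
      rw [show c j = ((m j + 1 : ℕ) : ℤ) by push_cast; linarith [hm j], Int.cast_natCast]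
    rw [h'] at h
    exact_mod_cast h
  · intro h
    refine ⟨fun j => m j + 1, ?_, fun j => by lia, fun j => by lia⟩
    have := mem_transversalhedron_of_forall_le h
    simpa using this

/-- If `m` is maximal, no exponent can be raised, so each `i` lies in a tight set. Submodularity
makes unions of tight sets tight, so the whole index set is tight and the degree is `|N([r])| - r`.
-/
theorem isPureOrderIdeal_latticeMonomials (E : Finset α) (A : Fin r → Set α) :
    IsPureOrderIdeal (latticeMonomials (transversalhedron (E : Set α) A)) := by
  have hdeg : ∀ m, Maximal (· ∈ latticeMonomials (transversalhedron (E : Set α) A)) m →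
      m.degree + r = #(nbr A E univ) := by
    intro m hm
    have hmem := mem_latticeMonomials_iff.1 hm.prop
    have htight : ∀ i, ∃ J : Finset (Fin r), i ∈ J ∧ ∑ j ∈ J, (m j + 1) = #(nbr A E J) := by
      intro i
      by_contra! hne
      have hlt : m < m + Finsupp.single i 1 := by
        refine lt_of_le_of_ne le_self_add fun h => ?_
        have := DFunLike.congr_fun h i
        simp at this
      refine hm.not_prop_of_gt hlt (mem_latticeMonomials_iff.2 fun J => ?_)
      have h1 := hmem J
      have h2 := hne J
      have h3 : ∑ j ∈ J, ((m + Finsupp.single i 1 : Fin r →₀ ℕ) j + 1) =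
          ∑ j ∈ J, (m j + 1) + if i ∈ J then 1 else 0 := by
        rw [← sum_ite_eq J i (fun _ => 1), ← sum_add_distrib]
        refine sum_congr rfl fun j _ => ?_
        rw [Finsupp.add_apply, Finsupp.single_apply]
        ring
      rw [h3]
      split_ifs with hi
      · have := h2 hi
        lia
      · exact h1
    choose T hiT hT using htight
    have hunion : ∀ s : Finset (Fin r),
        ∑ j ∈ s.biUnion T, (m j + 1) = #(nbr A E (s.biUnion T)) := by
      intro s
      induction s using Finset.induction_on with
      | empty => simp [nbr]
      | insert i s _ ih =>
        rw [biUnion_insert]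
        have h1 := card_nbr_submodular A E (T i) (s.biUnion T)
        have h2 := sum_union_inter (s₁ := T i) (s₂ := s.biUnion T) (f := fun j => m j + 1)
        have h3 := hmem (T i ∪ s.biUnion T)
        have h4 := hmem (T i ∩ s.biUnion T)
        have h5 := hT i
        lia
    have huniv : univ.biUnion T = univ :=
      eq_univ_iff_forall.2 fun i => mem_biUnion.2 ⟨i, mem_univ i, hiT i⟩
    have := hunion univ
    rw [huniv, sum_add_distrib] at this
    rw [Finsupp.degree_eq_sum]
    simpa using this
  refine ⟨?_, ?_, ?_⟩
  · refine (Set.finite_Iic (Finsupp.equivFunOnFinite.symm fun _ : Fin r => #E)).subset ?_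
    intro m hm j
    have h := mem_latticeMonomials_iff.1 hm {j}
    have h' := card_le_card (nbr_subset A E {j})
    rw [sum_singleton] at h
    simp only [Finsupp.equivFunOnFinite_symm_apply_apply]
    lia
  · intro m hm n hnm
    rw [mem_latticeMonomials_iff] at hm ⊢
    intro J
    exact (sum_le_sum fun j _ => Nat.succ_le_succ (hnm j)).trans (hm J)
  · intro m n hm hn
    have := hdeg m hm
    have := hdeg n hn
    lia

theorem degreeSequence_latticeMonomials (E : Finset α) (A : Fin r → Set α) (k : ℕ) :
    (degreeSequence (latticeMonomials (transversalhedron (E : Set α) A)) k : ℤ) =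
      (vectorPolynomial A univ E).coeff k := by
  have h : degreeSequence (latticeMonomials (transversalhedron (E : Set α) A)) k =
      #{c ∈ hallVectors A univ E | k = ∑ j, c j - #(univ : Finset (Fin r))} := by
    rw [degreeSequence, ← Set.ncard_coe_finset]
    refine Set.ncard_congr (fun m _ => fun j => m j + 1) ?_ ?_ ?_
    · rintro m ⟨hm, hk⟩
      rw [mem_coe, mem_filter, mem_hallVectors]
      refine ⟨⟨fun j _ => by lia, by simp, fun J _ => mem_latticeMonomials_iff.1 hm J⟩, ?_⟩
      rw [Finsupp.degree_eq_sum] at hk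
      rw [sum_add_distrib, hk]
      simp
    · intro m n _ _ hmn
      ext j
      have := congrFun hmn j
      lia
    · intro c hc
      rw [mem_coe, mem_filter, mem_hallVectors] at hc
      obtain ⟨⟨h1, -, h2⟩, h3⟩ := hc
      have hc1 : ∀ j, c j - 1 + 1 = c j := fun j => Nat.sub_add_cancel (h1 j (mem_univ j))
      refine ⟨Finsupp.equivFunOnFinite.symm fun j => c j - 1, ⟨?_, ?_⟩, ?_⟩
      · rw [mem_latticeMonomials_iff]
        intro J
        simpa [hc1] using h2 J (subset_univ J)
      · rw [Finsupp.degree_eq_sum, h3, ← sum_congr rfl fun j _ => hc1 j, sum_add_distrib]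
        simp
      · ext j
        simp [hc1]
  rw [h, vectorPolynomial, finsetSum_coeff]
  simp [coeff_X_pow]

end Polytope

end Cotransversal

theorem mainTheorem2 {α : Type*} (M : Matroid α) [M.Finite]
    (hM : Cotransversal.IsCotransversal M) (r : ℕ) (hr : (Matroid.dual M).eRank = r) :
    (∃ A : Fin r → Set α, Cotransversal.IsPresentation (Matroid.dual M) A) ∧
    ∀ A : Fin r → Set α, Cotransversal.IsPresentation (Matroid.dual M) A →
      Cotransversal.IsPureOrderIdeal
        (Cotransversal.latticeMonomials (Cotransversal.transversalhedron M.E A)) ∧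
      ∀ k : ℕ,
        (Cotransversal.degreeSequence
          (Cotransversal.latticeMonomials (Cotransversal.transversalhedron M.E A)) k : ℤ) =
        Cotransversal.hVector M k := by
  obtain ⟨m, A₀, hA₀⟩ := hM
  refine ⟨hA₀.exists_of_eRank_eq hr, fun A hA => ?_⟩
  have hE : (M.ground_finite.toFinset : Set α) = M.E := by simp
  rw [← hE]
  refine ⟨Cotransversal.isPureOrderIdeal_latticeMonomials _ A, fun k => ?_⟩
  rw [Cotransversal.degreeSequence_latticeMonomials,
    ← Cotransversal.setPolynomial_eq_vectorPolynomial,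
    ← Cotransversal.hPolynomial_eq_setPolynomial M hA hr, Cotransversal.hVector]
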